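/- Let $f$ be a holomorphic function in a neighbourhood of $0\in\mathbb{C}^3$ with Taylor expansion $\sum_{\nu\in\mathbb{N}^3} a_\nu z^\nu$ at $0$. Its Newton diagram is $\Gamma_+(f):=\operatorname{conv}\bigcup_{a_\nu\neq 0}(\nu+\mathbb{R}_+^3)$, where $\mathbb{R}_+=[0,\infty)$. A face of $\Gamma_+(f)$ is a set of the form $\{v\in\Gamma_+(f):\langle u,v\rangle=\inf_{w\in\Gamma_+(f)}\langle u,w\rangle\}$ with $u\in\mathbb{R}_+^3\setminus\{0\}$, and $\Gamma^k(f)$ denotes the set of all compact $k$-dimensional faces of $\Gamma_+(f)$. Let $\mathcal{J}$ be the family of all segments $I_1^k=\overline{(0,1,1)(k,0,0)}$, $I_2^k=\overline{(1,0,1)(0,k,0)}$, $I_3^k=\overline{(1,1,0)(0,0,k)}$ in $\mathbb{R}^3$ with $k\in\{2,3,\ldots\}$. Suppose that $f$ is an isolated singularity, i.e. $f$ is not identically zero near $0$, $f(0)=0$, $\nabla f(0)=0$, and $\nabla f(z)\neq 0$ for all $z\neq 0$ sufficiently close to $0$. If $\Gamma^2(f)=\emptyset$, then there exists $I\in\mathcal{J}$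 such that $\Gamma^1(f)=\{I\}$. -/

import Mathlib

open Filter Topology

noncomputable section

/-- The gradient `(∂f/∂z₁, …, ∂f/∂zₙ)` of `f : ℂⁿ → ℂ` at the point `z`. -/
def complexGradient {n : ℕ} (f : (Fin n → ℂ) → ℂ) (z : Fin n → ℂ) : Fin n → ℂ :=
  fun i => fderiv ℂ f z (Pi.single i 1)

/-- `f` is a singularity: a nonzero germ at `0` of a holomorphic function with `f(0) = 0` and
`∇f(0) = 0`. -/
structure IsSingularity {n : ℕ} (f : (Fin n → ℂ) → ℂ) : Prop where
  holomorphic : AnalyticAt ℂ f 0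
  ne_zero : ¬ (∀ᶠ z in 𝓝 (0 : Fin n → ℂ), f z = 0)
  map_zero : f 0 = 0
  gradient_zero : complexGradient f 0 = 0

/-- `f` is an isolated singularity: a singularity whose gradient has no zero `z ≠ 0` near `0`. -/
structure IsIsolatedSingularity {n : ℕ} (f : (Fin n → ℂ) → ℂ) : Prop
    extends IsSingularity f where
  isolated : ∀ᶠ z in 𝓝[≠] (0 : Fin n → ℂ), complexGradient f z ≠ 0

/-- The coefficient `a_ν = (∂^ν f)(0) / ν!` of `z^ν` in the Taylor expansion of `f` at `0`.
The derivative of order `|ν| = ν₁ + ⋯ + νₙ` is evaluated at the list of directions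
`e₁, …, e₁, e₂, …, e₂, …, eₙ, …, eₙ` in which `eᵢ` occurs `νᵢ` times. -/
def taylorCoeff {n : ℕ} (f : (Fin n → ℂ) → ℂ) (ν : Fin n → ℕ) : ℂ :=
  iteratedFDeriv ℂ (∑ i, ν i) f 0
    (fun j => Pi.single (finSigmaFinEquiv.symm j).1 (1 : ℂ)) / ((∏ i, (ν i).factorial : ℕ) : ℂ)

/-- The Newton diagram `Γ₊(f)`: the convex hull of the union of the sets `ν + ℝⁿ₊` over all `ν`
with `a_ν ≠ 0`. -/
def newtonDiagram {n : ℕ} (f : (Fin n → ℂ) → ℂ) : Set (Fin n → ℝ) :=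
  convexHull ℝ {x | ∃ ν : Fin n → ℕ, taylorCoeff f ν ≠ 0 ∧ ∀ i, (ν i : ℝ) ≤ x i}

/-- `l(u, A) = inf {⟨u, v⟩ : v ∈ A}`. -/
def supportValue {n : ℕ} (u : Fin n → ℝ) (A : Set (Fin n → ℝ)) : ℝ :=
  sInf ((fun v => ∑ i, u i * v i) '' A)

/-- `Δ(u, A) = {v ∈ A : ⟨u, v⟩ = l(u, A)}`. -/
def supportFace {n : ℕ} (u : Fin n → ℝ) (A : Set (Fin n → ℝ)) : Set (Fin n → ℝ) :=
  {v | v ∈ A ∧ ∑ i, u i * v i = supportValue u A}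

/-- The Newton boundary `Γ(f)`: the family of all compact faces of the Newton diagram, a face being
a set `Δ(u, Γ₊(f))` with `u ∈ ℝⁿ₊ \ {0}`. -/
def newtonBoundary {n : ℕ} (f : (Fin n → ℂ) → ℂ) : Set (Set (Fin n → ℝ)) :=
  {S | IsCompact S ∧
    ∃ u : Fin n → ℝ, (∀ i, 0 ≤ u i) ∧ u ≠ 0 ∧ S = supportFace u (newtonDiagram f)}

/-- `Γᵏ(f)`: the set of all compact faces of dimension `k`, the dimension of a face being that of
its affine hull. -/
def newtonFaces {n : ℕ} (f : (Fin n → ℂ) → ℂ) (k : ℕ) : Set (Set (Fin n → ℝ)) :=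
  {S | S ∈ newtonBoundary f ∧ Module.finrank ℝ (vectorSpan ℝ S) = k}

/-- The family of segments `I_j^k` in `ℝ³`, `j = 1, 2, 3`, `k = 2, 3, …`, where `I_j^k` joins the
point whose `j`-th coordinate is `0` and whose other two are `1` to the point `k` on the
`j`-th axis. -/
def segmentFamilyJ : Set (Set (Fin 3 → ℝ)) :=
  {I | ∃ (j : Fin 3) (k : ℕ), 2 ≤ k ∧
    I = segment ℝ (fun i => if i = j then (0 : ℝ) else 1) (Pi.single j (k : ℝ))}

end

/-!
If `∇f` has no zero other than `0`, then for each axis `i` the expansion of `f` contains a monomial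
`zᵢᵃ zⱼ`, since otherwise `∇f` vanishes on that axis. It also contains a monomial without `zᵢ`:
otherwise every `∂f/∂zⱼ` with `j ≠ i` vanishes on the hyperplane `zᵢ = 0`, and `∂f/∂zᵢ` has zeros
there arbitrarily close to `0`, because zeros of holomorphic functions of two variables are not
isolated.

Without compact faces of dimension two, the exponents minimizing a positive weight are collinear.
Hence a nonnegative functional `v` which is constant on a compact edge is minimized by that edge
over the whole diagram: if not, add multiples of `v` to the weight of the edge until a further
exponent becomes minimal, and the minimal exponents are no longer collinear. Evaluating suitable
functionals `v` at the monomials above shows that the edge is some `I_j^k`, and evaluating them at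
the ends of a second edge shows that there is only one.
-/

section Zeros

theorem exists_mem_ball_eq_zero_of_norm_lt_on_sphere {f : ℂ → ℂ} {c : ℂ} {r : ℝ} (hr : 0 < r)
    (hf : DiffContOnCl ℂ f (Metric.ball c r)) (hlt : ∀ z ∈ Metric.sphere c r, ‖f c‖ < ‖f z‖) :
    ∃ z ∈ Metric.ball c r, f z = 0 := by
  by_contra! hne
  have hc : c ∈ Metric.ball c r := Metric.mem_ball_self hr
  have hne_closure : ∀ z ∈ closure (Metric.ball c r), f z ≠ 0 := by
    rw [closure_ball c hr.ne', ← Metric.ball_union_sphere]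
    rintro z (hz | hz)
    · exact hne z hz
    · exact norm_pos_iff.1 ((norm_nonneg _).trans_lt (hlt z hz))
  obtain ⟨z, hz, hmax⟩ := Complex.exists_mem_frontier_isMaxOn_norm Metric.isBounded_ball ⟨c, hc⟩
    (hf.inv hne_closure)
  have hinv : ‖(f c)⁻¹‖ ≤ ‖(f z)⁻¹‖ := hmax (subset_closure hc)
  rw [norm_inv, norm_inv, inv_le_inv₀ (norm_pos_iff.2 (hne c hc))
    (norm_pos_iff.2 (hne_closure z (frontier_subset_closure hz)))] at hinv
  rw [frontier_ball c hr.ne'] at hz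
  exact (hlt z hz).not_ge hinv

variable {E : Type*} [NormedAddCommGroup E] [NormedSpace ℂ E] {h : ℂ × E → ℂ} {x : ℂ} {y : E}

theorem eventually_exists_mem_ball_eq_zero (hh : AnalyticAt ℂ h (x, y)) (h0 : h (x, y) = 0)
    (hne : ∃ᶠ x' in 𝓝 x, h (x', y) ≠ 0) {r : ℝ} (hr : 0 < r) :
    ∀ᶠ y' in 𝓝 y, ∃ x' ∈ Metric.ball x r, h (x', y') = 0 := by
  have hslice : AnalyticAt ℂ (fun x' => h (x', y)) x := hh.along_fst
  have hne' : ∀ᶠ x' in 𝓝 x, x' ≠ x → h (x', y) ≠ 0 := eventually_nhdsWithin_iff.1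
    (hslice.eventually_eq_zero_or_eventually_ne_zero.resolve_left fun hzero =>
      hne (hzero.mono fun _ => not_not.2))
  obtain ⟨U, hU, V, hV, hUV⟩ := mem_nhds_prod_iff.1 hh.eventually_analyticAt
  obtain ⟨ρ, hρ, hball⟩ := Metric.nhds_basis_closedBall.mem_iff.1 (inter_mem hne' hU)
  set s := min ρ r
  have hs : 0 < s := lt_min hρ hr
  replace hball := (Metric.closedBall_subset_closedBall (min_le_left ρ r)).trans hball
  have hanalytic : ∀ x' ∈ Metric.closedBall x s, ∀ y' ∈ V, AnalyticAt ℂ h (x', y') :=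
    fun x' hx' y' hy' => hUV ⟨(hball hx').2, hy'⟩
  have hlt : ∀ᶠ y' in 𝓝 y, ∀ x' ∈ Metric.sphere x s, ‖h (x, y')‖ < ‖h (x', y')‖ := by
    refine (isCompact_sphere x s).eventually_forall_of_forall_eventually fun x' hx' => ?_
    have hx'_ball := Metric.sphere_subset_closedBall hx'
    refine ContinuousAt.eventually_lt (f := fun p : E × ℂ => ‖h (x, p.1)‖)
      (g := fun p : E × ℂ => ‖h (p.2, p.1)‖) ?_ ?_ ?_
    · exact ContinuousAt.norm (ContinuousAt.comp' (g := h) (f := fun p : E × ℂ => (x, p.1))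
        hh.continuousAt (by fun_prop))
    · exact ContinuousAt.norm (ContinuousAt.comp' (g := h) (f := fun p : E × ℂ => (p.2, p.1))
        (hanalytic x' hx'_ball y (mem_of_mem_nhds hV)).continuousAt (by fun_prop))
    · rw [h0, norm_zero, norm_pos_iff]
      exact (hball hx'_ball).1 (Metric.ne_of_mem_sphere hx' hs.ne')
  filter_upwards [hlt, hV] with y' hy' hy'V
  have hdiff : DifferentiableOn ℂ (fun x' => h (x', y')) (Metric.closedBall x s) := fun x' hx' =>
    (hanalytic x' hx' y' hy'V).along_fst.differentiableAt.differentiableWithinAt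
  obtain ⟨x', hx', hzero⟩ := exists_mem_ball_eq_zero_of_norm_lt_on_sphere hs
    (hdiff.diffContOnCl_ball subset_rfl) hy'
  exact ⟨x', Metric.ball_subset_ball (min_le_right ρ r) hx', hzero⟩

theorem frequently_eq_zero_of_analyticAt [Nontrivial E] (hh : AnalyticAt ℂ h (x, y))
    (h0 : h (x, y) = 0) : ∃ᶠ p in 𝓝[≠] (x, y), h p = 0 := by
  rw [frequently_nhdsWithin_iff]
  by_cases hne : ∃ᶠ x' in 𝓝 x, h (x', y) ≠ 0
  · refine (Metric.nhds_basis_ball.prod_nhds Metric.nhds_basis_ball).frequently_iff.2 ?_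
    rintro ⟨r, s⟩ ⟨hr, hs⟩
    have hy : ∀ᶠ y' in 𝓝[≠] y, (∃ x' ∈ Metric.ball x r, h (x', y') = 0) ∧ y' ∈ Metric.ball y s :=
      ((eventually_exists_mem_ball_eq_zero hh h0 hne hr).and
        (Metric.ball_mem_nhds y hs)).filter_mono nhdsWithin_le_nhds
    have := Module.punctured_nhds_neBot ℂ E y
    obtain ⟨y', ⟨⟨x', hx', hzero⟩, hy'⟩, hy'_ne⟩ := (hy.and eventually_mem_nhdsWithin).exists
    exact ⟨(x', y'), ⟨hx', hy'⟩, hzero, fun hp => hy'_ne (congrArg Prod.snd hp)⟩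
  · have hslice : ∃ᶠ x' in 𝓝[≠] x, h (x', y) = 0 :=
      ((not_frequently.1 hne).mono fun _ => not_not.1).filter_mono nhdsWithin_le_nhds |>.frequently
    have hcont : Tendsto (fun x' => (x', y)) (𝓝 x) (𝓝 (x, y)) :=
      (Continuous.prodMk_left y).tendsto x
    refine hcont.frequently ((frequently_nhdsWithin_iff.1 hslice).mono fun x' hx' => ?_)
    exact ⟨hx'.1, fun hp => hx'.2 (congrArg Prod.fst hp)⟩

end Zeros

section Taylor

theorem eventually_eq_zero_of_iteratedFDeriv_eq_zero {𝕜 E F : Type*}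
    [NontriviallyNormedField 𝕜] [CharZero 𝕜] [NormedAddCommGroup E] [NormedSpace 𝕜 E]
    [NormedAddCommGroup F] [NormedSpace 𝕜 F] [CompleteSpace F] {f : E → F} {x : E}
    (hf : AnalyticAt 𝕜 f x) :
    ∀ᶠ y in 𝓝 0, (∀ m, iteratedFDeriv 𝕜 m f x (fun _ => y) = 0) → f (x + y) = 0 := by
  obtain ⟨p, r, hp⟩ := hf
  filter_upwards [Metric.eball_mem_nhds (0 : E) hp.r_pos] with y hy hzero
  refine (hp.hasSum_iteratedFDeriv hy).unique ?_
  simpa only [hzero, smul_zero] using hasSum_zero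

variable {n : ℕ} {f : (Fin n → ℂ) → ℂ}

theorem iteratedFDeriv_single_eq_factorial_mul_taylorCoeff (hf : AnalyticAt ℂ f 0) {m : ℕ}
    (r : Fin m → Fin n) {ν : Fin n → ℕ} (hr : ∀ i, Fintype.card {k // r k = i} = ν i) :
    iteratedFDeriv ℂ m f 0 (fun k => Pi.single (r k) 1) =
      ((∏ i, (ν i).factorial : ℕ) : ℂ) * taylorCoeff f ν := by
  obtain rfl : m = ∑ i, ν i := by
    simp_rw [← hr]
    rw [← Fintype.card_sigma, Fintype.card_congr (Equiv.sigmaFiberEquiv r), Fintype.card_fin]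
  let e : (Σ i, Fin (ν i)) ≃ Σ i, {k // r k = i} :=
    Equiv.sigmaCongrRight fun i => (Fintype.equivFinOfCardEq (hr i)).symm
  let σ : Equiv.Perm (Fin (∑ i, ν i)) :=
    finSigmaFinEquiv.symm.trans (e.trans (Equiv.sigmaFiberEquiv r))
  have hσ : ∀ k, r (σ k) = (finSigmaFinEquiv.symm k).1 := fun k =>
    (e (finSigmaFinEquiv.symm k)).2.2
  have hfact : ((∏ i, (ν i).factorial : ℕ) : ℂ) ≠ 0 :=
    Nat.cast_ne_zero.2 (Finset.prod_ne_zero_iff.2 fun i _ => (ν i).factorial_ne_zero)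
  rw [taylorCoeff, mul_div_cancel₀ _ hfact,
    ← (hf.contDiffAt (n := ⊤)).iteratedFDeriv_comp_perm (fun k => Pi.single (r k) (1 : ℂ)) σ]
  simp only [Function.comp_def, hσ]

theorem analyticAt_complexGradient_apply {z : Fin n → ℂ} (hf : AnalyticAt ℂ f z) (j : Fin n) :
    AnalyticAt ℂ (fun z => complexGradient f z j) z :=
  ((ContinuousLinearMap.apply ℂ ℂ (Pi.single j (1 : ℂ))).analyticAt _).fun_comp hf.fderiv

theorem iteratedFDeriv_complexGradient_apply (hf : AnalyticAt ℂ f 0) (j : Fin n) {m : ℕ}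
    (w : Fin m → Fin n → ℂ) :
    iteratedFDeriv ℂ m (fun z => complexGradient f z j) 0 w =
      iteratedFDeriv ℂ (m + 1) f 0 (Fin.snoc w (Pi.single j 1)) := by
  rw [iteratedFDeriv_succ_apply_right, Fin.init_snoc, Fin.snoc_last]
  have := (ContinuousLinearMap.apply ℂ ℂ (Pi.single j (1 : ℂ))).iteratedFDeriv_comp_left
    (hf.fderiv.contDiffAt (n := m)) le_rfl
  exact congrArg (· w) this

theorem card_finSigmaFinEquiv_symm_fst_eq (ν : Fin n → ℕ) (i : Fin n) :
    Fintype.card {k : Fin (∑ i, ν i) // (finSigmaFinEquiv.symm k).1 = i} = ν i := by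
  rw [Fintype.card_congr ((finSigmaFinEquiv (n := ν)).symm.subtypeEquiv
    (q := fun x => x.1 = i) fun _ => Iff.rfl),
    Fintype.card_congr (Equiv.sigmaSubtype i), Fintype.card_fin]

theorem card_snoc_eq {m : ℕ} (r : Fin m → Fin n) (j i : Fin n) :
    Fintype.card {k // (Fin.snoc r j : Fin (m + 1) → Fin n) k = i} =
      Fintype.card {k // r k = i} + (Pi.single j 1 : Fin n → ℕ) i := by
  rw [Fintype.card_subtype, Fintype.card_subtype, Finset.card_filter, Finset.card_filter,
    Fin.sum_univ_castSucc]
  simp [Pi.single_apply, eq_comm]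

theorem prod_factorial_add_single {ι : Type*} [Fintype ι] [DecidableEq ι] (ν : ι → ℕ) (j : ι) :
    ∏ i, ((ν + Pi.single j 1 : ι → ℕ) i).factorial = (ν j + 1) * ∏ i, (ν i).factorial := by
  rw [← Finset.mul_prod_erase _ _ (Finset.mem_univ j),
    ← Finset.mul_prod_erase _ (fun i => (ν i).factorial) (Finset.mem_univ j), ← mul_assoc,
    Pi.add_apply, Pi.single_eq_same, Nat.factorial_succ]
  congr 1
  refine Finset.prod_congr rfl fun i hi => ?_
  rw [Pi.add_apply, Pi.single_eq_of_ne (Finset.ne_of_mem_erase hi), add_zero]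

theorem taylorCoeff_complexGradient_apply (hf : AnalyticAt ℂ f 0) (j : Fin n) (ν : Fin n → ℕ) :
    taylorCoeff (fun z => complexGradient f z j) ν =
      (ν j + 1) * taylorCoeff f (ν + Pi.single j 1) := by
  let r : Fin (∑ i, ν i) → Fin n := fun k => (finSigmaFinEquiv.symm k).1
  have hr : ∀ i, Fintype.card {k // r k = i} = ν i := card_finSigmaFinEquiv_symm_fst_eq ν
  have hsnoc : (Fin.snoc (fun k => Pi.single (r k) 1) (Pi.single j 1) :
      Fin (∑ i, ν i + 1) → Fin n → ℂ) =
        fun k => Pi.single ((Fin.snoc r j : Fin (∑ i, ν i + 1) → Fin n) k) 1 := by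
    funext k
    refine Fin.lastCases ?_ (fun k => ?_) k <;> simp only [Fin.snoc_last, Fin.snoc_castSucc]
  have hfact : ((∏ i, (ν i).factorial : ℕ) : ℂ) ≠ 0 :=
    Nat.cast_ne_zero.2 (Finset.prod_ne_zero_iff.2 fun i _ => (ν i).factorial_ne_zero)
  refine mul_left_cancel₀ hfact ?_
  calc
    _ = iteratedFDeriv ℂ (∑ i, ν i) (fun z => complexGradient f z j) 0
          (fun k => Pi.single (r k) 1) :=
      (iteratedFDeriv_single_eq_factorial_mul_taylorCoeff
        (analyticAt_complexGradient_apply hf j) r hr).symm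
    _ = iteratedFDeriv ℂ (∑ i, ν i + 1) f 0
          (fun k => Pi.single ((Fin.snoc r j : Fin (∑ i, ν i + 1) → Fin n) k) 1) := by
      rw [iteratedFDeriv_complexGradient_apply hf, hsnoc]
    _ = ((∏ i, ((ν + Pi.single j 1 : Fin n → ℕ) i).factorial : ℕ) : ℂ) *
          taylorCoeff f (ν + Pi.single j 1) :=
      iteratedFDeriv_single_eq_factorial_mul_taylorCoeff hf _ fun i => by
        rw [card_snoc_eq, hr, Pi.add_apply]
    _ = _ := by
      rw [prod_factorial_add_single]
      push_cast
      ring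

theorem eventually_eq_zero_of_support_subset (hf : AnalyticAt ℂ f 0) {s : Set (Fin n)}
    (hs : ∀ ν : Fin n → ℕ, Function.support ν ⊆ s → taylorCoeff f ν = 0) :
    ∀ᶠ z in 𝓝 0, Function.support z ⊆ s → f z = 0 := by
  filter_upwards [eventually_eq_zero_of_iteratedFDeriv_eq_zero hf] with z hz hzs
  rw [← zero_add z]
  refine hz fun m => ?_
  rw [pi_eq_sum_univ' z, ContinuousMultilinearMap.map_sum]
  refine Finset.sum_eq_zero fun r _ => ?_
  rw [ContinuousMultilinearMap.map_smul_univ]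
  by_cases hr : ∀ k, r k ∈ s
  · have hsupp : Function.support (fun i => Fintype.card {k // r k = i}) ⊆ s := by
      intro i hi
      obtain ⟨k, rfl⟩ := Fintype.card_pos_iff.1 (Nat.pos_of_ne_zero hi)
      exact hr k
    rw [iteratedFDeriv_single_eq_factorial_mul_taylorCoeff hf r fun _ => rfl, hs _ hsupp,
      mul_zero, smul_zero]
  · obtain ⟨k, hk⟩ := not_forall.1 hr
    have hzk : z (r k) = 0 := Function.notMem_support.1 fun hzk => hk (hzs hzk)
    rw [Finset.prod_eq_zero (Finset.mem_univ k) hzk, zero_smul]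

theorem eventually_complexGradient_apply_eq_zero (hf : AnalyticAt ℂ f 0) {s : Set (Fin n)}
    (j : Fin n)
    (hs : ∀ ν : Fin n → ℕ, Function.support ν ⊆ s → taylorCoeff f (ν + Pi.single j 1) = 0) :
    ∀ᶠ z in 𝓝 0, Function.support z ⊆ s → complexGradient f z j = 0 :=
  eventually_eq_zero_of_support_subset (analyticAt_complexGradient_apply hf j) fun ν hν => by
    rw [taylorCoeff_complexGradient_apply hf, hs ν hν, mul_zero]

end Taylor

section IsolatedSingularity

variable {n : ℕ} {f : (Fin n → ℂ) → ℂ}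

theorem IsSingularity.two_le_sum (hf : IsSingularity f) {ν : Fin n → ℕ}
    (hν : taylorCoeff f ν ≠ 0) : 2 ≤ ∑ i, ν i := by
  have hlow : ∀ m < 2, ∀ r : Fin m → Fin n,
      iteratedFDeriv ℂ m f 0 (fun k => Pi.single (r k) (1 : ℂ)) = 0 := by
    intro m hm r
    interval_cases m
    · rw [iteratedFDeriv_zero_apply, hf.map_zero]
    · rw [iteratedFDeriv_one_apply]
      exact congrFun hf.gradient_zero (r 0)
  by_contra! hlt
  exact hν (by rw [taylorCoeff, hlow _ hlt, zero_div])

theorem tendsto_nhdsNE_of_injective {X Y : Type*} [TopologicalSpace X] [TopologicalSpace Y]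
    {g : X → Y} {x : X} (hg : ContinuousAt g x) (hinj : Function.Injective g) :
    Tendsto g (𝓝[≠] x) (𝓝[≠] (g x)) :=
  hg.continuousWithinAt.tendsto_nhdsWithin fun _ hy => hinj.ne hy

theorem IsIsolatedSingularity.exists_taylorCoeff_single_add_single_ne_zero
    (hf : IsIsolatedSingularity f) (i : Fin n) :
    ∃ (a : ℕ) (j : Fin n), taylorCoeff f (Pi.single i a + Pi.single j 1) ≠ 0 := by
  by_contra! hzero
  have hgrad : ∀ᶠ z in 𝓝 0, ∀ j, Function.support z ⊆ {i} → complexGradient f z j = 0 := by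
    refine eventually_all.2 fun j =>
      eventually_complexGradient_apply_eq_zero hf.holomorphic j fun ν hν => ?_
    have hν_single : ν = Pi.single i (ν i) := funext fun l => by
      by_cases hl : l = i
      · rw [hl, Pi.single_eq_same]
      · rw [Pi.single_eq_of_ne hl, Function.notMem_support.1 fun h => hl (hν h)]
    rw [hν_single]
    exact hzero (ν i) j
  have haxis : Tendsto (fun t : ℂ => (Pi.single i t : Fin n → ℂ)) (𝓝[≠] 0) (𝓝[≠] 0) := by
    have hinj : Function.Injective fun t : ℂ => (Pi.single i t : Fin n → ℂ) := fun _ _ =>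
      (Pi.single_inj i).1
    have hcont := continuous_single (A := fun _ : Fin n => ℂ) i
    simpa only [Pi.single_zero] using tendsto_nhdsNE_of_injective hcont.continuousAt hinj (x := 0)
  obtain ⟨t, ht_grad, ht⟩ := ((haxis.eventually (hgrad.filter_mono nhdsWithin_le_nhds)).and
    (haxis.eventually hf.isolated)).exists
  exact ht (funext fun j => ht_grad j Pi.support_single_subset)

theorem exists_continuousLinearMap_prod_injective_support_subset {𝕜 ι : Type*} [Semiring 𝕜]
    [TopologicalSpace 𝕜] [ContinuousAdd 𝕜] {s : Set ι} (hs : s.Nontrivial) :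
    ∃ L : 𝕜 × 𝕜 →L[𝕜] ι → 𝕜, Function.Injective L ∧ ∀ p, Function.support (L p) ⊆ s := by
  classical
  obtain ⟨j, hj, k, hk, hjk⟩ := hs
  let L : 𝕜 × 𝕜 →L[𝕜] ι → 𝕜 :=
    (ContinuousLinearMap.single 𝕜 (fun _ => 𝕜) j).coprod
      (ContinuousLinearMap.single 𝕜 (fun _ => 𝕜) k)
  have hL_apply : ∀ p, L p = Pi.single j p.1 + Pi.single k p.2 := fun p => rfl
  refine ⟨L, fun p q hpq => ?_, fun p l hl => ?_⟩
  · have hpj := congrFun hpq j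
    have hpk := congrFun hpq k
    simp only [hL_apply, Pi.add_apply, Pi.single_eq_same, Pi.single_eq_of_ne hjk,
      Pi.single_eq_of_ne hjk.symm, add_zero, zero_add] at hpj hpk
    exact Prod.ext hpj hpk
  · by_contra hls
    have hlj : l ≠ j := fun h => hls (h ▸ hj)
    have hlk : l ≠ k := fun h => hls (h ▸ hk)
    exact hl (by rw [hL_apply, Pi.add_apply, Pi.single_eq_of_ne hlj, Pi.single_eq_of_ne hlk,
      add_zero])

theorem IsIsolatedSingularity.exists_taylorCoeff_ne_zero_apply_eq_zero
    (hf : IsIsolatedSingularity f) (hn : 3 ≤ n) (i : Fin n) :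
    ∃ ν : Fin n → ℕ, taylorCoeff f ν ≠ 0 ∧ ν i = 0 := by
  by_contra! hno
  have hgrad : ∀ᶠ z in 𝓝 0, ∀ l ≠ i, Function.support z ⊆ {i}ᶜ → complexGradient f z l = 0 := by
    refine eventually_all.2 fun l => eventually_imp_distrib_left.2 fun hl =>
      eventually_complexGradient_apply_eq_zero hf.holomorphic l fun ν hν => ?_
    by_contra hne
    refine hno _ hne ?_
    rw [Pi.add_apply, Pi.single_eq_of_ne hl.symm, add_zero]
    exact Function.notMem_support.1 fun hi => hν hi rfl
  have hnontrivial : ({i}ᶜ : Set (Fin n)).Nontrivial := by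
    rw [← Set.one_lt_ncard_iff_nontrivial, Set.ncard_compl, Set.ncard_singleton, Nat.card_fin]
    omega
  obtain ⟨L, hL_injective, hL_support⟩ :=
    exists_continuousLinearMap_prod_injective_support_subset (𝕜 := ℂ) hnontrivial
  have hL_tendsto : Tendsto L (𝓝[≠] 0) (𝓝[≠] 0) := by
    simpa only [map_zero] using
      tendsto_nhdsNE_of_injective L.continuous.continuousAt hL_injective (x := 0)
  have hanalytic : AnalyticAt ℂ (fun p => complexGradient f (L p) i) 0 :=
    AnalyticAt.fun_comp (g := fun z => complexGradient f z i) (by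
      rw [map_zero]
      exact analyticAt_complexGradient_apply hf.holomorphic i) (L.analyticAt 0)
  have hfreq : ∃ᶠ p in 𝓝[≠] 0, complexGradient f (L p) i = 0 :=
    frequently_eq_zero_of_analyticAt hanalytic (by
      rw [Prod.mk_zero_zero, map_zero, hf.gradient_zero, Pi.zero_apply])
  obtain ⟨p, hp_i, hp_ne, hp⟩ := (hfreq.and_eventually ((hL_tendsto.eventually hf.isolated).and
    (hL_tendsto.eventually (hgrad.filter_mono nhdsWithin_le_nhds)))).exists
  refine hp_ne (funext fun l => ?_)
  by_cases hl : l = i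
  · rw [hl, hp_i, Pi.zero_apply]
  · exact hp l hl (hL_support p)

end IsolatedSingularity

section Weights

variable {ι : Type*}

/-- The exponent `ν` as a point of the space in which the Newton diagram lives. -/
def exponentPoint (ν : ι → ℕ) : ι → ℝ := fun i => ν i

theorem exponentPoint_injective :
    Function.Injective (exponentPoint : (ι → ℕ) → ι → ℝ) := fun _ _ h =>
  funext fun i => Nat.cast_injective (congrFun h i)

theorem exponentPoint_nonneg (ν : ι → ℕ) : 0 ≤ exponentPoint ν := fun i => Nat.cast_nonneg (ν i)

variable [Fintype ι]

theorem exponentPoint_dotProduct_exponentPoint (μ ν : ι → ℕ) :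
    exponentPoint μ ⬝ᵥ exponentPoint ν = (μ ⬝ᵥ ν : ℕ) :=
  (Nat.castRingHom ℝ).map_dotProduct μ ν |>.symm

/-- The exponents in `S` of smallest weight `⟨u, ν⟩`: those of the monomials of the initial form
with respect to `u`, and the points of the support on the face of the Newton diagram cut out by
`u`. -/
def minimalExponents (S : Set (ι → ℕ)) (u : ι → ℝ) : Set (ι → ℕ) :=
  {ν | ν ∈ S ∧ IsMinOn (fun ξ => u ⬝ᵥ exponentPoint ξ) S ν}

variable {S : Set (ι → ℕ)} {u v : ι → ℝ} {μ ν ξ : ι → ℕ}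

theorem tendsto_dotProduct_exponentPoint_cofinite (hu : ∀ i, 0 < u i) :
    Tendsto (fun ν => u ⬝ᵥ exponentPoint ν) cofinite atTop := by
  classical
  refine tendsto_atTop.2 fun C => (Set.finite_Iic fun i => ⌊C / u i⌋₊).subset fun ν hν i => ?_
  have hlt : u ⬝ᵥ exponentPoint ν < C := not_le.1 hν
  refine Nat.le_floor ((le_div_iff₀' (hu i)).2 (le_trans ?_ hlt.le))
  exact Finset.single_le_sum (f := fun i => u i * exponentPoint ν i)
    (fun i _ => mul_nonneg (hu i).le (exponentPoint_nonneg ν i)) (Finset.mem_univ i)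

theorem minimalExponents_nonempty (hu : ∀ i, 0 < u i) (hS : S.Nonempty) :
    (minimalExponents S u).Nonempty :=
  (tendsto_dotProduct_exponentPoint_cofinite hu).exists_within_forall_le hS

theorem dotProduct_eq_of_mem_minimalExponents (hμ : μ ∈ minimalExponents S u)
    (hν : ν ∈ minimalExponents S u) : u ⬝ᵥ exponentPoint μ = u ⬝ᵥ exponentPoint ν :=
  le_antisymm (hμ.2 hν.1) (hν.2 hμ.1)

theorem mem_minimalExponents_of_dotProduct_eq (hμ : μ ∈ minimalExponents S u) (hν : ν ∈ S)
    (h : u ⬝ᵥ exponentPoint ν = u ⬝ᵥ exponentPoint μ) : ν ∈ minimalExponents S u :=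
  ⟨hν, fun _ hξ => h.trans_le (hμ.2 hξ)⟩

theorem minimalExponents_finite (hu : ∀ i, 0 < u i) (S : Set (ι → ℕ)) :
    (minimalExponents S u).Finite := by
  obtain h | ⟨μ, hμ⟩ := (minimalExponents S u).eq_empty_or_nonempty
  · exact h ▸ Set.finite_empty
  · have hgt := (tendsto_dotProduct_exponentPoint_cofinite hu).eventually_gt_atTop
      (u ⬝ᵥ exponentPoint μ)
    exact (eventually_cofinite.1 hgt).subset fun ν hν =>
      (dotProduct_eq_of_mem_minimalExponents hμ hν).ge.not_gt

theorem exists_apply_lt_of_mem_minimalExponents (hu : ∀ i, 0 < u i)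
    (hμ : μ ∈ minimalExponents S u) (hν : ν ∈ minimalExponents S u) (hne : μ ≠ ν) :
    ∃ i, ν i < μ i := by
  by_contra! hle
  refine hne (funext fun i => ?_)
  have hsum := (Finset.sum_eq_sum_iff_of_le fun i _ =>
    mul_le_mul_of_nonneg_left (Nat.cast_le.2 (hle i)) (hu i).le).1
      (dotProduct_eq_of_mem_minimalExponents hμ hν) i (Finset.mem_univ i)
  exact Nat.cast_injective (mul_left_cancel₀ (hu i).ne' hsum)

-- Minimize the slope `(a x - a μ) / (b μ - b x)` over the `x` with `b x < b μ`.
theorem exists_isMinOn_add_mul {α : Type*} {a b : α → ℝ} {S : Set α} {μ ξ : α}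
    (ha : Tendsto a cofinite atTop) (hb : ∀ x ∈ S, 0 ≤ b x) (hμ : IsMinOn a S μ) (hξ : ξ ∈ S)
    (hlt : b ξ < b μ) :
    ∃ s, 0 ≤ s ∧ IsMinOn (fun x => a x + s * b x) S μ ∧
      ∃ ζ ∈ S, b ζ < b μ ∧ a ζ + s * b ζ = a μ + s * b μ := by
  let T := {x | x ∈ S ∧ b x < b μ}
  let slope : T → ℝ := fun x => (a x - a μ) / (b μ - b x)
  have hslope_le : ∀ (s : ℝ) (x : T), s ≤ slope x ↔ s * (b μ - b x) ≤ a x - a μ := fun s x =>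
    le_div_iff₀ (sub_pos.2 x.2.2)
  have hle_slope : ∀ x : T, (a x - a μ) / b μ ≤ slope x := fun x =>
    div_le_div_of_nonneg_left (sub_nonneg.2 (hμ x.2.1)) (sub_pos.2 x.2.2)
      (sub_le_self _ (hb x x.2.1))
  have hslope : Tendsto slope cofinite atTop := by
    refine tendsto_atTop_mono hle_slope (Tendsto.atTop_div_const ((hb ξ hξ).trans_lt hlt) ?_)
    exact tendsto_atTop_add_const_right _ _ (ha.comp Subtype.val_injective.tendsto_cofinite)
  have : Nonempty T := ⟨ξ, hξ, hlt⟩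
  obtain ⟨ζ, hζ⟩ := hslope.exists_forall_le
  have hs : 0 ≤ slope ζ := div_nonneg (sub_nonneg.2 (hμ ζ.2.1)) (sub_pos.2 ζ.2.2).le
  have hζ_eq : slope ζ * (b μ - b ζ) = a ζ - a μ := div_mul_cancel₀ _ (sub_pos.2 ζ.2.2).ne'
  refine ⟨slope ζ, hs, fun x hx => ?_, ζ, ζ.2.1, ζ.2.2, by linarith⟩
  change a μ + slope ζ * b μ ≤ a x + slope ζ * b x
  obtain hbx | hbx := lt_or_ge (b x) (b μ)
  · linarith [(hslope_le _ ⟨x, hx, hbx⟩).1 (hζ ⟨x, hx, hbx⟩)]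
  · exact add_le_add (hμ hx) (mul_le_mul_of_nonneg_left hbx hs)

theorem exists_mem_minimalExponents_add_smul (hu : ∀ i, 0 < u i) (hv : 0 ≤ v)
    (hμ : μ ∈ minimalExponents S u) (hξ : ξ ∈ S)
    (hlt : v ⬝ᵥ exponentPoint ξ < v ⬝ᵥ exponentPoint μ) :
    ∃ s : ℝ, 0 ≤ s ∧ μ ∈ minimalExponents S (u + s • v) ∧
      ∃ ζ ∈ minimalExponents S (u + s • v), v ⬝ᵥ exponentPoint ζ < v ⬝ᵥ exponentPoint μ := by
  obtain ⟨s, hs, hmin, ζ, hζ, hζ_lt, hζ_eq⟩ := exists_isMinOn_add_mul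
    (b := fun ν => v ⬝ᵥ exponentPoint ν) (tendsto_dotProduct_exponentPoint_cofinite hu)
    (fun ν _ => dotProduct_nonneg_of_nonneg hv (exponentPoint_nonneg ν)) hμ.2 hξ hlt
  have hweight : ∀ ν, (u + s • v) ⬝ᵥ exponentPoint ν =
      u ⬝ᵥ exponentPoint ν + s * v ⬝ᵥ exponentPoint ν := fun ν => by
    rw [add_dotProduct, smul_dotProduct, smul_eq_mul]
  have hμ' : μ ∈ minimalExponents S (u + s • v) := ⟨hμ.1, by simpa only [hweight] using hmin⟩
  exact ⟨s, hs, hμ', ζ, mem_minimalExponents_of_dotProduct_eq hμ' hζ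
    (by rw [hweight, hweight, hζ_eq]), hζ_lt⟩

/-- The minimal exponents of each positive weight lie on a line: a Newton diagram with support `S`
has no compact face of dimension larger than one. -/
def HasCollinearMinimalExponents (S : Set (ι → ℕ)) : Prop :=
  ∀ u : ι → ℝ, (∀ i, 0 < u i) → Collinear ℝ (exponentPoint '' minimalExponents S u)

namespace HasCollinearMinimalExponents

theorem dotProduct_eq (hS : HasCollinearMinimalExponents S) (hu : ∀ i, 0 < u i)
    (hμ : μ ∈ minimalExponents S u) (hν : ν ∈ minimalExponents S u) (hne : μ ≠ ν)
    (heq : v ⬝ᵥ exponentPoint μ = v ⬝ᵥ exponentPoint ν) (hξ : ξ ∈ minimalExponents S u) :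
    v ⬝ᵥ exponentPoint ξ = v ⬝ᵥ exponentPoint μ := by
  have hline := (hS u hu).mem_affineSpan_of_mem_of_ne (Set.mem_image_of_mem _ hμ)
    (Set.mem_image_of_mem _ hν) (Set.mem_image_of_mem _ hξ) (exponentPoint_injective.ne hne)
  obtain ⟨r, hr⟩ := mem_affineSpan_pair_iff_exists_lineMap_eq.1 hline
  rw [← hr, AffineMap.lineMap_apply, vsub_eq_sub, vadd_eq_add, dotProduct_add, dotProduct_smul,
    dotProduct_sub, heq, sub_self, smul_zero, zero_add]

-- Otherwise, tilting `u` towards `v` would make an exponent off the line `μν` minimal with them.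
theorem isMinOn (hS : HasCollinearMinimalExponents S) (hu : ∀ i, 0 < u i)
    (hμ : μ ∈ minimalExponents S u) (hν : ν ∈ minimalExponents S u) (hne : μ ≠ ν) (hv : 0 ≤ v)
    (heq : v ⬝ᵥ exponentPoint μ = v ⬝ᵥ exponentPoint ν) :
    IsMinOn (fun ξ => v ⬝ᵥ exponentPoint ξ) S μ := by
  intro ξ hξ
  by_contra hlt
  obtain ⟨s, hs, hμ', ζ, hζ, hζ_lt⟩ :=
    exists_mem_minimalExponents_add_smul hu hv hμ hξ (not_le.1 hlt)
  have hν' : ν ∈ minimalExponents S (u + s • v) :=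
    mem_minimalExponents_of_dotProduct_eq hμ' hν.1 (by
      rw [add_dotProduct, add_dotProduct, smul_dotProduct, smul_dotProduct, heq,
        dotProduct_eq_of_mem_minimalExponents hμ hν])
  exact hζ_lt.ne (hS.dotProduct_eq
    (fun i => add_pos_of_pos_of_nonneg (hu i) (mul_nonneg hs (hv i))) hμ' hν' hne heq hζ)

theorem natCast_dotProduct_le (hS : HasCollinearMinimalExponents S) (hu : ∀ i, 0 < u i)
    (hμ : μ ∈ minimalExponents S u) (hν : ν ∈ minimalExponents S u) (hne : μ ≠ ν) {w : ι → ℕ}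
    (heq : w ⬝ᵥ μ = w ⬝ᵥ ν) (hξ : ξ ∈ S) : w ⬝ᵥ μ ≤ w ⬝ᵥ ξ := by
  have hle := hS.isMinOn hu hμ hν hne (exponentPoint_nonneg w)
    (by simp only [exponentPoint_dotProduct_exponentPoint, heq]) hξ
  simpa only [Set.mem_ofPred_eq, exponentPoint_dotProduct_exponentPoint, Nat.cast_le] using hle

end HasCollinearMinimalExponents

end Weights

section IsolatedSupport

/-- The conditions that being isolated imposes on the support `S` of a singularity: no monomial of
degree less than two, a monomial `zᵢᵃ zⱼ` for each axis `i`, and a monomial in the remaining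
variables for each coordinate hyperplane `zᵢ = 0`. -/
structure IsIsolatedSupport {ι : Type*} [Fintype ι] [DecidableEq ι] (S : Set (ι → ℕ)) : Prop where
  two_le_sum : ∀ ν ∈ S, 2 ≤ ∑ i, ν i
  exists_axis : ∀ i, ∃ a j, Pi.single i a + Pi.single j 1 ∈ S
  exists_hyperplane : ∀ i, ∃ ν ∈ S, ν i = 0

/-- The exponents at the ends of the segment `I_i^m` of `segmentFamilyJ`. -/
def segmentEnds (i : Fin 3) (m : ℕ) : Set (Fin 3 → ℕ) :=
  {Pi.single i m, Function.update (1 : Fin 3 → ℕ) i 0}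

theorem IsIsolatedSupport.exists_nontrivial_minimalExponents {ι : Type*} [Fintype ι]
    [DecidableEq ι] [Nonempty ι] {S : Set (ι → ℕ)} (hS : IsIsolatedSupport S) :
    ∃ u : ι → ℝ, (∀ i, 0 < u i) ∧ (minimalExponents S u).Nontrivial := by
  obtain ⟨ν, hν, -⟩ := hS.exists_hyperplane (Classical.arbitrary ι)
  obtain ⟨μ, hμ⟩ := minimalExponents_nonempty (u := 1) (fun _ => one_pos) ⟨ν, hν⟩
  obtain ⟨i, -, hi⟩ := Finset.exists_ne_zero_of_sum_ne_zero
    (two_pos.trans_le (hS.two_le_sum μ hμ.1)).ne'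
  obtain ⟨ξ, hξ, hξi⟩ := hS.exists_hyperplane i
  have hsingle : (0 : ι → ℝ) ≤ Pi.single i 1 := Pi.single_nonneg.2 zero_le_one
  obtain ⟨s, hs, hμ', ζ, hζ, hlt⟩ :=
    exists_mem_minimalExponents_add_smul (fun _ => one_pos) hsingle hμ hξ (by
      simpa [exponentPoint, hξi] using Nat.pos_of_ne_zero hi)
  exact ⟨_, fun l => add_pos_of_pos_of_nonneg one_pos (mul_nonneg hs (hsingle l)),
    μ, hμ', ζ, hζ, fun h => hlt.ne (h ▸ rfl)⟩

theorem eq_or_eq_or_eq_of_ne {i j k : Fin 3} (hij : i ≠ j) (hik : i ≠ k) (hjk : j ≠ k)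
    (l : Fin 3) : l = i ∨ l = j ∨ l = k := by
  revert i j k l; decide

theorem sum_eq_add_add_of_ne {M : Type*} [AddCommMonoid M] {i j k : Fin 3} (hij : i ≠ j)
    (hik : i ≠ k) (hjk : j ≠ k) (g : Fin 3 → M) : ∑ l, g l = g i + g j + g k := by
  have huniv : (Finset.univ : Finset (Fin 3)) = {i, j, k} := by
    revert i j k; decide
  rw [huniv, Finset.sum_insert (by simp [hij, hik]), Finset.sum_pair hjk, add_assoc]

variable {S : Set (Fin 3 → ℕ)} {u v : Fin 3 → ℝ} {μ ν ξ : Fin 3 → ℕ} {i j k : Fin 3} {m m' : ℕ}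

namespace HasCollinearMinimalExponents

theorem le_of_segmentEnds_subset (hc : HasCollinearMinimalExponents S) (hu : ∀ i, 0 < u i)
    (hm : m ≠ 0) (hends : segmentEnds i m ⊆ minimalExponents S u) (hij : i ≠ j) (hξ : ξ ∈ S) :
    m ≤ ξ i + m * ξ j := by
  obtain ⟨hμ, hν⟩ := Set.pair_subset_iff.1 hends
  have hne : (Pi.single i m : Fin 3 → ℕ) ≠ Function.update (1 : Fin 3 → ℕ) i 0 := fun h => hm (by
    simpa using congrFun h i)
  have hle := hc.natCast_dotProduct_le (w := Pi.single i 1 + Pi.single j m) hu hμ hν hne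
    (by simp [add_dotProduct, hij.symm]) hξ
  simpa [add_dotProduct, hij.symm] using hle

theorem eq_and_eq_of_segmentEnds_subset (hc : HasCollinearMinimalExponents S)
    (hu : ∀ i, 0 < u i) (hv : ∀ i, 0 < v i) (hm : 2 ≤ m) (hm' : 2 ≤ m')
    (hends : segmentEnds i m ⊆ minimalExponents S u)
    (hends' : segmentEnds j m' ⊆ minimalExponents S v) : i = j ∧ m = m' := by
  obtain ⟨hμ, -⟩ := Set.pair_subset_iff.1 hends
  obtain ⟨hμ', hν'⟩ := Set.pair_subset_iff.1 hends'
  obtain rfl | hij := eq_or_ne i j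
  · obtain ⟨k, hik⟩ := exists_ne i
    have hle := hc.le_of_segmentEnds_subset hu (by omega) hends hik.symm hμ'.1
    have hge := hc.le_of_segmentEnds_subset hv (by omega) hends' hik.symm hμ.1
    simp only [Pi.single_eq_same, Pi.single_eq_of_ne hik, mul_zero, add_zero] at hle hge
    exact ⟨rfl, hle.antisymm hge⟩
  · have hle := hc.le_of_segmentEnds_subset hu (by omega) hends hij hν'.1
    simp only [Function.update_self, Function.update_of_ne hij, Pi.one_apply, mul_zero] at hle
    omega

end HasCollinearMinimalExponents

theorem eq_zero_and_eq_one_and_eq_zero_of_mul_add_mul_le {p q x y : ℕ} (hp : 0 < p) (hq : 0 < q)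
    (h : q * (x + p) + p * y ≤ q) : x = 0 ∧ p = 1 ∧ y = 0 := by
  have hxp : x + p = 1 := by nlinarith
  have hy : p * y = 0 := by nlinarith
  exact ⟨by omega, by omega, (mul_eq_zero.1 hy).resolve_left hp.ne'⟩

namespace IsIsolatedSupport

-- Compare the edge with the monomial that `S` has near the `k`-th axis, with respect to the
-- functional on the `i`-`j`-plane that is constant on the edge.
theorem apply_eq_zero_of_lt_of_lt (hS : IsIsolatedSupport S) (hc : HasCollinearMinimalExponents S)
    (hu : ∀ i, 0 < u i) (hμ : μ ∈ minimalExponents S u) (hν : ν ∈ minimalExponents S u)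
    (hij : i ≠ j) (hik : i ≠ k) (hjk : j ≠ k) (hi : ν i < μ i) (hj : μ j < ν j) :
    ν i = 0 ∧ μ j = 0 ∧ (μ i = 1 ∨ ν j = 1) := by
  obtain ⟨p, hp⟩ := Nat.exists_eq_add_of_le hi.le
  obtain ⟨q, hq⟩ := Nat.exists_eq_add_of_le hj.le
  obtain ⟨a, l, hal⟩ := hS.exists_axis k
  have hle := hc.natCast_dotProduct_le (w := Pi.single i q + Pi.single j p) hu hμ hν
    (fun h => hi.ne (by rw [h])) (by
      simp only [add_dotProduct, single_dotProduct, hp, hq]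
      ring) hal
  simp only [add_dotProduct, single_dotProduct, Pi.add_apply, Pi.single_eq_of_ne hik,
    Pi.single_eq_of_ne hjk, zero_add, hp] at hle
  obtain rfl | rfl | rfl := eq_or_eq_or_eq_of_ne hij hik hjk l
  · rw [Pi.single_eq_same, Pi.single_eq_of_ne hij.symm, mul_one, mul_zero, add_zero] at hle
    obtain ⟨hνi, hp1, hμj⟩ := eq_zero_and_eq_one_and_eq_zero_of_mul_add_mul_le
      (by omega) (by omega) hle
    omega
  · rw [Pi.single_eq_same, Pi.single_eq_of_ne hij, mul_one, mul_zero, zero_add] at hle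
    obtain ⟨hμj, hq1, hνi⟩ := eq_zero_and_eq_one_and_eq_zero_of_mul_add_mul_le
      (p := q) (q := p) (x := μ l) (y := ν i) (by omega) (by omega) (by linarith)
    omega
  · rw [Pi.single_eq_of_ne hik, Pi.single_eq_of_ne hjk, mul_zero, mul_zero] at hle
    exact absurd hle (Nat.add_pos_left (mul_pos (by omega) (by omega)) _).not_ge

theorem apply_ne_of_lt_of_lt (hS : IsIsolatedSupport S) (hc : HasCollinearMinimalExponents S)
    (hu : ∀ i, 0 < u i) (hμ : μ ∈ minimalExponents S u) (hν : ν ∈ minimalExponents S u)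
    (hij : i ≠ j) (hik : i ≠ k) (hjk : j ≠ k) (hi : ν i < μ i) (hj : μ j < ν j) :
    μ k ≠ ν k := by
  intro hk
  obtain ⟨hνi, hμj, hone⟩ := hS.apply_eq_zero_of_lt_of_lt hc hu hμ hν hij hik hjk hi hj
  obtain ⟨ξ, hξ, hξk⟩ := hS.exists_hyperplane k
  have hμk := hc.natCast_dotProduct_le (w := Pi.single k 1) hu hμ hν
    (fun h => hi.ne (by rw [h])) (by simp [hk]) hξ
  simp only [single_dotProduct, one_mul, hξk] at hμk
  have hμ_sum := hS.two_le_sum μ hμ.1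
  have hν_sum := hS.two_le_sum ν hν.1
  rw [sum_eq_add_add_of_ne hij hik hjk] at hμ_sum hν_sum
  omega

theorem eq_segmentEnds_of_lt_of_lt_of_lt (hS : IsIsolatedSupport S)
    (hc : HasCollinearMinimalExponents S) (hu : ∀ i, 0 < u i) (hμ : μ ∈ minimalExponents S u)
    (hν : ν ∈ minimalExponents S u) (hij : i ≠ j) (hik : i ≠ k) (hjk : j ≠ k) (hi : ν i < μ i)
    (hj : μ j < ν j) (hk : μ k < ν k) : 2 ≤ μ i ∧ {μ, ν} = segmentEnds i (μ i) := by
  obtain ⟨hνi, hμj, hone_j⟩ := hS.apply_eq_zero_of_lt_of_lt hc hu hμ hν hij hik hjk hi hj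
  obtain ⟨-, hμk, hone_k⟩ := hS.apply_eq_zero_of_lt_of_lt hc hu hμ hν hik hij hjk.symm hi hk
  have hμ_sum := hS.two_le_sum μ hμ.1
  rw [sum_eq_add_add_of_ne hij hik hjk] at hμ_sum
  have hμ_eq : μ = Pi.single i (μ i) := by
    funext l
    obtain rfl | rfl | rfl := eq_or_eq_or_eq_of_ne hij hik hjk l
    · rw [Pi.single_eq_same]
    · rw [Pi.single_eq_of_ne hij.symm, hμj]
    · rw [Pi.single_eq_of_ne hik.symm, hμk]
  have hν_eq : ν = Function.update (1 : Fin 3 → ℕ) i 0 := by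
    rw [Function.eq_update_iff]
    refine ⟨hνi, fun l hl => ?_⟩
    obtain rfl | rfl | rfl := eq_or_eq_or_eq_of_ne hij hik hjk l
    · exact absurd rfl hl
    · rw [Pi.one_apply]; omega
    · rw [Pi.one_apply]; omega
  refine ⟨by omega, ?_⟩
  rw [segmentEnds, ← hμ_eq, ← hν_eq]

theorem exists_pair_eq_segmentEnds (hS : IsIsolatedSupport S)
    (hc : HasCollinearMinimalExponents S) (hu : ∀ i, 0 < u i) (hμ : μ ∈ minimalExponents S u)
    (hν : ν ∈ minimalExponents S u) (hne : μ ≠ ν) :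
    ∃ i m, 2 ≤ m ∧ {μ, ν} = segmentEnds i m := by
  obtain ⟨i, hi⟩ := exists_apply_lt_of_mem_minimalExponents hu hμ hν hne
  obtain ⟨j, hj⟩ := exists_apply_lt_of_mem_minimalExponents hu hν hμ hne.symm
  have hij : i ≠ j := fun h => hi.not_gt (h ▸ hj)
  obtain ⟨k, hik, hjk⟩ : ∃ k, i ≠ k ∧ j ≠ k := by
    clear hi hj
    revert i j; decide
  obtain hk | hk := (hS.apply_ne_of_lt_of_lt hc hu hμ hν hij hik hjk hi hj).lt_or_gt
  · exact ⟨i, _, hS.eq_segmentEnds_of_lt_of_lt_of_lt hc hu hμ hν hij hik hjk hi hj hk⟩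
  · rw [Set.pair_comm]
    exact ⟨j, _, hS.eq_segmentEnds_of_lt_of_lt_of_lt hc hu hν hμ hij.symm hjk hik hj hi hk⟩

theorem exists_minimalExponents_eq_segmentEnds (hS : IsIsolatedSupport S)
    (hc : HasCollinearMinimalExponents S) (hu : ∀ i, 0 < u i)
    (hnt : (minimalExponents S u).Nontrivial) :
    ∃ i m, 2 ≤ m ∧ minimalExponents S u = segmentEnds i m := by
  obtain ⟨μ, hμ, ν, hν, hne⟩ := hnt
  obtain ⟨i, m, hm, hpair⟩ := hS.exists_pair_eq_segmentEnds hc hu hμ hν hne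
  have hends : segmentEnds i m ⊆ minimalExponents S u := hpair ▸ Set.pair_subset hμ hν
  refine ⟨i, m, hm, Set.Subset.antisymm (fun ξ hξ => ?_) hends⟩
  obtain rfl | hξμ := eq_or_ne ξ μ
  · exact hpair ▸ Set.mem_insert ξ {ν}
  · obtain ⟨j, m', hm', hpair'⟩ := hS.exists_pair_eq_segmentEnds hc hu hξ hμ hξμ
    obtain ⟨rfl, rfl⟩ := hc.eq_and_eq_of_segmentEnds_subset hu hu hm hm' hends
      (hpair' ▸ Set.pair_subset hξ hμ)
    exact hpair' ▸ Set.mem_insert ξ {μ}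

theorem exists_forall_minimalExponents_eq_segmentEnds (hS : IsIsolatedSupport S)
    (hc : HasCollinearMinimalExponents S) :
    ∃ i m, 2 ≤ m ∧ (∃ u : Fin 3 → ℝ, (∀ i, 0 < u i) ∧ minimalExponents S u = segmentEnds i m) ∧
      ∀ u : Fin 3 → ℝ, (∀ i, 0 < u i) → (minimalExponents S u).Nontrivial →
        minimalExponents S u = segmentEnds i m := by
  obtain ⟨u, hu, hnt⟩ := hS.exists_nontrivial_minimalExponents
  obtain ⟨i, m, hm, hends⟩ := hS.exists_minimalExponents_eq_segmentEnds hc hu hnt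
  refine ⟨i, m, hm, ⟨u, hu, hends⟩, fun v hv hnt' => ?_⟩
  obtain ⟨j, m', hm', hends'⟩ := hS.exists_minimalExponents_eq_segmentEnds hc hv hnt'
  obtain ⟨rfl, rfl⟩ := hc.eq_and_eq_of_segmentEnds_subset hu hv hm hm' hends.ge hends'.ge
  exact hends'

end IsIsolatedSupport

end IsolatedSupport

section Faces

theorem convexHull_inter_hyperplane {𝕜 E : Type*} [Field 𝕜] [LinearOrder 𝕜]
    [IsStrictOrderedRing 𝕜] [AddCommGroup E] [Module 𝕜 E] (l : E →ₗ[𝕜] 𝕜) {A : Set E} {c : 𝕜}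
    (hA : ∀ x ∈ A, c ≤ l x) :
    convexHull 𝕜 A ∩ {x | l x = c} = convexHull 𝕜 (A ∩ {x | l x = c}) := by
  have hhull : convexHull 𝕜 A ⊆ {x | c ≤ l x ∧
      (l x = c → x ∈ convexHull 𝕜 (A ∩ {x | l x = c}))} := by
    refine convexHull_min (fun x hx => ⟨hA x hx, fun h => subset_convexHull 𝕜 _ ⟨hx, h⟩⟩) ?_
    refine convex_iff_forall_pos.2 ?_
    rintro x ⟨hx, hx_mem⟩ y ⟨hy, hy_mem⟩ a b ha hb hab
    have hcomb : l (a • x + b • y) - c = a * (l x - c) + b * (l y - c) := by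
      rw [map_add, map_smul, map_smul, smul_eq_mul, smul_eq_mul]
      linear_combination c * hab
    have hax := mul_nonneg ha.le (sub_nonneg.2 hx)
    have hby := mul_nonneg hb.le (sub_nonneg.2 hy)
    refine ⟨by linarith, fun heq => ?_⟩
    rw [heq, sub_self, eq_comm, add_eq_zero_iff_of_nonneg hax hby] at hcomb
    exact convex_convexHull 𝕜 _
      (hx_mem (sub_eq_zero.1 ((mul_eq_zero.1 hcomb.1).resolve_left ha.ne')))
      (hy_mem (sub_eq_zero.1 ((mul_eq_zero.1 hcomb.2).resolve_left hb.ne'))) ha.le hb.le hab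
  refine Set.Subset.antisymm (fun x hx => (hhull hx.1).2 hx.2) (Set.subset_inter ?_ ?_)
  · exact convexHull_mono Set.inter_subset_left
  · exact convexHull_min Set.inter_subset_right (convex_hyperplane l.isLinear c)

section Dominating

variable {ι : Type*} [Fintype ι] {S : Set (ι → ℕ)} {u : ι → ℝ} {μ : ι → ℕ}

theorem dotProduct_le_of_mem_upperClosure (hu : ∀ i, 0 < u i) (hμ : μ ∈ minimalExponents S u)
    {x : ι → ℝ} (hx : x ∈ upperClosure (exponentPoint '' S)) : u ⬝ᵥ exponentPoint μ ≤ u ⬝ᵥ x := by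
  obtain ⟨_, ⟨ν, hν, rfl⟩, hle⟩ := mem_upperClosure.1 hx
  exact (hμ.2 hν).trans (dotProduct_le_dotProduct_of_nonneg_left hle fun i => (hu i).le)

theorem upperClosure_inter_hyperplane (hu : ∀ i, 0 < u i) (hμ : μ ∈ minimalExponents S u) :
    ↑(upperClosure (exponentPoint '' S)) ∩ {x | u ⬝ᵥ x = u ⬝ᵥ exponentPoint μ} =
      exponentPoint '' minimalExponents S u := by
  refine Set.Subset.antisymm ?_ ?_
  · rintro x ⟨hx, hxμ⟩
    obtain ⟨_, ⟨ν, hν, rfl⟩, hle⟩ := mem_upperClosure.1 hx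
    have hle_u : ∀ i ∈ Finset.univ, u i * exponentPoint ν i ≤ u i * x i := fun i _ =>
      mul_le_mul_of_nonneg_left (hle i) (hu i).le
    have heq : u ⬝ᵥ exponentPoint ν = u ⬝ᵥ x :=
      (Finset.sum_le_sum hle_u).antisymm (hxμ.trans_le (hμ.2 hν))
    refine ⟨ν, mem_minimalExponents_of_dotProduct_eq hμ hν (heq.trans hxμ), funext fun i => ?_⟩
    exact mul_left_cancel₀ (hu i).ne'
      ((Finset.sum_eq_sum_iff_of_le hle_u).1 heq i (Finset.mem_univ i))
  · rintro _ ⟨ν, hν, rfl⟩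
    exact ⟨subset_upperClosure (Set.mem_image_of_mem _ hν.1),
      dotProduct_eq_of_mem_minimalExponents hν hμ⟩

theorem finrank_vectorSpan_minimalExponents_lt [Nonempty ι] (hu : ∀ i, 0 < u i) :
    Module.finrank ℝ (vectorSpan ℝ (exponentPoint '' minimalExponents S u)) < Fintype.card ι := by
  have hker : vectorSpan ℝ (exponentPoint '' minimalExponents S u) ≤
      LinearMap.ker (dotProductBilin ℝ ℝ u) := by
    refine Submodule.span_le.2 ?_
    rintro _ ⟨_, ⟨μ, hμ, rfl⟩, _, ⟨ν, hν, rfl⟩, rfl⟩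
    change u ⬝ᵥ (exponentPoint μ - exponentPoint ν) = 0
    rw [dotProduct_sub, dotProduct_eq_of_mem_minimalExponents hμ hν, sub_self]
  rw [← Module.finrank_fintype_fun_eq_card ℝ]
  refine Submodule.finrank_lt (ne_top_of_le_ne_top (fun htop => ?_) hker)
  have hu_ker : u ∈ LinearMap.ker (dotProductBilin ℝ ℝ u) := htop ▸ Submodule.mem_top
  exact (hu (Classical.arbitrary ι)).ne' (congrFun (dotProduct_self_eq_zero.1 hu_ker) _)

end Dominating

/-- The set of exponents of the monomials of the Taylor expansion of `f` at `0`. -/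
def taylorSupport {n : ℕ} (f : (Fin n → ℂ) → ℂ) : Set (Fin n → ℕ) := {ν | taylorCoeff f ν ≠ 0}

theorem IsIsolatedSingularity.isIsolatedSupport {n : ℕ} {f : (Fin n → ℂ) → ℂ}
    (hf : IsIsolatedSingularity f) (hn : 3 ≤ n) : IsIsolatedSupport (taylorSupport f) where
  two_le_sum _ hν := hf.toIsSingularity.two_le_sum hν
  exists_axis := hf.exists_taylorCoeff_single_add_single_ne_zero
  exists_hyperplane := hf.exists_taylorCoeff_ne_zero_apply_eq_zero hn

variable {n : ℕ} {f : (Fin n → ℂ) → ℂ} {u : Fin n → ℝ}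

theorem newtonDiagram_eq_convexHull_upperClosure (f : (Fin n → ℂ) → ℂ) :
    newtonDiagram f = convexHull ℝ ↑(upperClosure (exponentPoint '' taylorSupport f)) := by
  rw [newtonDiagram]
  congr 1
  ext x
  rw [SetLike.mem_coe, mem_upperClosure, Set.exists_mem_image]
  rfl

theorem supportValue_newtonDiagram (hu : ∀ i, 0 < u i) {μ : Fin n → ℕ}
    (hμ : μ ∈ minimalExponents (taylorSupport f) u) :
    supportValue u (newtonDiagram f) = u ⬝ᵥ exponentPoint μ := by
  rw [newtonDiagram_eq_convexHull_upperClosure]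
  refine IsLeast.csInf_eq ⟨⟨exponentPoint μ, subset_convexHull ℝ _
    (subset_upperClosure (Set.mem_image_of_mem _ hμ.1)), rfl⟩, ?_⟩
  rintro _ ⟨x, hx, rfl⟩
  exact convexHull_min (fun x hx => dotProduct_le_of_mem_upperClosure hu hμ hx)
    (convex_halfSpace_ge (dotProductBilin ℝ ℝ u).isLinear (u ⬝ᵥ exponentPoint μ)) hx

theorem supportFace_newtonDiagram (hu : ∀ i, 0 < u i) :
    supportFace u (newtonDiagram f) =
      convexHull ℝ (exponentPoint '' minimalExponents (taylorSupport f) u) := by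
  obtain hS | hS := (taylorSupport f).eq_empty_or_nonempty
  · simp [supportFace, newtonDiagram_eq_convexHull_upperClosure, minimalExponents, hS]
  obtain ⟨μ, hμ⟩ := minimalExponents_nonempty hu hS
  calc
    supportFace u (newtonDiagram f) =
        newtonDiagram f ∩ {x | dotProductBilin ℝ ℝ u x = u ⬝ᵥ exponentPoint μ} := by
      rw [← supportValue_newtonDiagram hu hμ]
      rfl
    _ = convexHull ℝ (↑(upperClosure (exponentPoint '' taylorSupport f)) ∩
        {x | dotProductBilin ℝ ℝ u x = u ⬝ᵥ exponentPoint μ}) := by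
      rw [newtonDiagram_eq_convexHull_upperClosure]
      exact convexHull_inter_hyperplane _ fun x hx => dotProduct_le_of_mem_upperClosure hu hμ hx
    _ = _ := congrArg (convexHull ℝ) (upperClosure_inter_hyperplane hu hμ)

theorem isCompact_supportFace_newtonDiagram (hu : ∀ i, 0 < u i) :
    IsCompact (supportFace u (newtonDiagram f)) := by
  rw [supportFace_newtonDiagram hu]
  exact ((minimalExponents_finite hu _).image _).isCompact_convexHull ℝ

theorem isUpperSet_newtonDiagram (f : (Fin n → ℂ) → ℂ) : IsUpperSet (newtonDiagram f) := by
  rw [newtonDiagram_eq_convexHull_upperClosure]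
  intro x y hxy hx
  have htranslate : convexHull ℝ ↑(upperClosure (exponentPoint '' taylorSupport f)) ⊆
      {z | z + (y - x) ∈ convexHull ℝ ↑(upperClosure (exponentPoint '' taylorSupport f))} :=
    convexHull_min (fun z hz => subset_convexHull ℝ _
      ((upperClosure _).upper (le_add_of_nonneg_right (sub_nonneg.2 hxy)) hz))
      ((convex_convexHull ℝ _).translate_preimage_left _)
  simpa using htranslate hx

-- If `u i = 0`, the face is invariant under translation along the `i`-th axis.
theorem pos_of_isCompact_supportFace (hu : ∀ i, 0 ≤ u i)
    (hcompact : IsCompact (supportFace u (newtonDiagram f)))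
    (hne : (supportFace u (newtonDiagram f)).Nonempty) (i : Fin n) : 0 < u i := by
  refine (hu i).lt_of_ne' fun hui => ?_
  obtain ⟨x, hx⟩ := hne
  have htranslate : ∀ t : ℝ, 0 ≤ t → x + Pi.single i t ∈ supportFace u (newtonDiagram f) := by
    refine fun t ht => ⟨isUpperSet_newtonDiagram f
      (le_add_of_nonneg_right (Pi.single_nonneg.2 ht)) hx.1, ?_⟩
    change u ⬝ᵥ (x + Pi.single i t) = _
    rw [dotProduct_add, dotProduct_single, hui, zero_mul, add_zero]
    exact hx.2
  obtain ⟨C, hC⟩ := (hcompact.image (continuous_apply i)).bddAbove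
  have hxC : x i ≤ C := hC ⟨x, hx, rfl⟩
  have hC_lt : (x + Pi.single i (C - x i + 1) : Fin n → ℝ) i ≤ C :=
    hC ⟨_, htranslate (C - x i + 1) (by linarith), rfl⟩
  rw [Pi.add_apply, Pi.single_eq_same] at hC_lt
  linarith

theorem mem_newtonFaces_iff [NeZero n] {k : ℕ} (hk : k ≠ 0) {F : Set (Fin n → ℝ)} :
    F ∈ newtonFaces f k ↔ ∃ u : Fin n → ℝ, (∀ i, 0 < u i) ∧
      convexHull ℝ (exponentPoint '' minimalExponents (taylorSupport f) u) = F ∧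
      Module.finrank ℝ
        (vectorSpan ℝ (exponentPoint '' minimalExponents (taylorSupport f) u)) = k := by
  have hspan : ∀ A : Set (Fin n → ℝ), vectorSpan ℝ (convexHull ℝ A) = vectorSpan ℝ A := fun A => by
    rw [← direction_affineSpan, affineSpan_convexHull, direction_affineSpan]
  constructor
  · rintro ⟨⟨hcompact, u, hu, -, rfl⟩, hdim⟩
    have hne : (supportFace u (newtonDiagram f)).Nonempty := by
      by_contra hempty
      rw [Set.not_nonempty_iff_eq_empty.1 hempty, vectorSpan_empty, finrank_bot] at hdim
      exact hk hdim.symm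
    have hpos := pos_of_isCompact_supportFace hu hcompact hne
    rw [supportFace_newtonDiagram hpos, hspan] at hdim
    exact ⟨u, hpos, (supportFace_newtonDiagram hpos).symm, hdim⟩
  · rintro ⟨u, hu, rfl, hdim⟩
    refine ⟨?_, by rw [hspan, hdim]⟩
    rw [← supportFace_newtonDiagram hu]
    exact ⟨isCompact_supportFace_newtonDiagram hu, u, fun i => (hu i).le,
      fun h => (hu 0).ne' (congrFun h 0), rfl⟩

theorem hasCollinearMinimalExponents_taylorSupport {f : (Fin 3 → ℂ) → ℂ}
    (hf : newtonFaces f 2 = ∅) : HasCollinearMinimalExponents (taylorSupport f) := by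
  intro u hu
  rw [collinear_iff_finrank_le_one]
  by_contra! hlt
  have hlt_three := finrank_vectorSpan_minimalExponents_lt (S := taylorSupport f) hu
  rw [Fintype.card_fin] at hlt_three
  exact Set.eq_empty_iff_forall_notMem.1 hf _
    ((mem_newtonFaces_iff two_ne_zero).2 ⟨u, hu, rfl, by omega⟩)

theorem convexHull_image_segmentEnds (i : Fin 3) (m : ℕ) :
    convexHull ℝ (exponentPoint '' segmentEnds i m) =
      segment ℝ (fun l => if l = i then (0 : ℝ) else 1) (Pi.single i (m : ℝ)) := by
  have hsingle : exponentPoint (Pi.single i m) = Pi.single i (m : ℝ) := by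
    funext l
    simp [exponentPoint, Pi.single_apply]
  have hones : exponentPoint (Function.update (1 : Fin 3 → ℕ) i 0) =
      fun l => if l = i then (0 : ℝ) else 1 := by
    funext l
    simp [exponentPoint, Function.update_apply]
  rw [segmentEnds, Set.image_pair, convexHull_pair, hsingle, hones, segment_symm]

theorem finrank_vectorSpan_segmentEnds (i : Fin 3) {m : ℕ} (hm : m ≠ 0) :
    Module.finrank ℝ (vectorSpan ℝ (exponentPoint '' segmentEnds i m)) = 1 := by
  rw [segmentEnds, Set.image_pair, vectorSpan_pair, finrank_span_singleton]
  refine vsub_ne_zero.2 (exponentPoint_injective.ne fun h => hm ?_)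
  simpa using congrFun h i

theorem nontrivial_of_finrank_vectorSpan_image_ne_zero {k V P α : Type*} [DivisionRing k]
    [AddCommGroup V] [Module k V] [AddTorsor V P] {p : α → P} {A : Set α}
    (h : Module.finrank k (vectorSpan k (p '' A)) ≠ 0) : A.Nontrivial := by
  by_contra hsub
  rw [vectorSpan_of_subsingleton k ((Set.not_nontrivial_iff.1 hsub).image p), finrank_bot] at h
  exact h rfl

end Faces

theorem proposition2 (f : (Fin 3 → ℂ) → ℂ) (hf : IsIsolatedSingularity f)
    (h2 : newtonFaces f 2 = ∅) :
    ∃ I ∈ segmentFamilyJ, newtonFaces f 1 = {I} := by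
  obtain ⟨i, m, hm, ⟨u, hu, hu_ends⟩, hends⟩ :=
    (hf.isIsolatedSupport le_rfl).exists_forall_minimalExponents_eq_segmentEnds
      (hasCollinearMinimalExponents_taylorSupport h2)
  refine ⟨_, ⟨i, m, hm, rfl⟩, Set.ext fun F => ?_⟩
  rw [Set.mem_singleton_iff, mem_newtonFaces_iff one_ne_zero, ← convexHull_image_segmentEnds]
  constructor
  · rintro ⟨v, hv, rfl, hdim⟩
    rw [hends v hv (nontrivial_of_finrank_vectorSpan_image_ne_zero (hdim ▸ one_ne_zero))]
  · rintro rfl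
    exact ⟨u, hu, by rw [hu_ends],
      by rw [hu_ends, finrank_vectorSpan_segmentEnds i (by omega)]⟩
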